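/- Let $N\ge 1$ and $m=\lfloor (N-1)/2\rfloor$. Let $\Omega_N\subset\mathbf{R}^N$ be the set of $(a_1,\dots,a_N)$ such that all complex roots of $P(x)=x^N+a_1x^{N-1}+\dots+a_N$ have absolute value at most $1$, equipped with Lebesgue measure $dV$ normalized to have total mass $1$. Then the distribution of $|a_N|=|P(0)|$ on $\Omega_N$ is the measure on $[0,1]$ $$\frac{(1-x^2)^m}{\int_0^1(1-t^2)^m\,dt}\,dx=\frac{2}{\sqrt{\pi}}\cdot\frac{\Gamma(m+3/2)}{\Gamma(m+1)}\,(1-x^2)^m\,dx .$$ Moreover, for every complex $\alpha$ with $\operatorname{Re}\alpha>0$, the function $|a_N|^{\alpha-1}$ is integrable on $\Omega_N$ and $$\frac{\int_{\Omega_N}|a_N|^{\alpha-1}\,dV}{\int_{\Omega_N}dV}=\prod_{k=0}^{m}\frac{1+2k}{\alpha+2k}.$$ These two descriptions are equivalent: a probability measure $\nu$ on $[0,1]$ is equal to the measure above if and only if, for every complex $\alpha$ with $\operatorname{Re}\alpha>0$, $x^{\alpha-1}$ is $\nu$-integrable and $\int x^{\alpha-1}\,d\nu(x)=\prod_{k=0}^{m}\frac{1+2k}{\alpha+2k}$.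 -/

import Mathlib

open MeasureTheory ProbabilityTheory Polynomial

noncomputable section

/-- The monic real polynomial `P(x) = x^N + a_1 x^(N-1) + ... + a_N` with coefficient vector
`(a_1, ..., a_N)`; the coordinate `a i` (with `i : Fin N`) is the coefficient `a_{i+1}`. -/
def monicPoly {N : ℕ} (a : Fin N → ℝ) : ℝ[X] :=
  X ^ N + ∑ i : Fin N, C (a i) * X ^ (N - 1 - (i : ℕ))

/-- The region `Ω_N` in `ℝ^N` parametrizing monic real polynomials of degree `N` all of whose
complex roots have absolute value at most one. -/
def polyRegion (N : ℕ) : Set (Fin N → ℝ) :=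
  {a | ∀ z : ℂ, aeval z (monicPoly a) = 0 → ‖z‖ ≤ 1}

/-- The normalized Lebesgue measure `dV / Vol(Ω_N)` on `Ω_N`, as a measure on `ℝ^N`. -/
def uniformPoly (N : ℕ) : Measure (Fin N → ℝ) :=
  cond (volume : Measure (Fin N → ℝ)) (polyRegion N)

/-- The function `|P(0)| = |a_N|`. -/
def absConstTerm {N : ℕ} (a : Fin N → ℝ) : ℝ :=
  |(monicPoly a).eval 0|

/-- The constant `(2 / √π) * Γ(m + 3/2) / Γ(m + 1)`. -/
def normConst (m : ℕ) : ℝ :=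
  2 / √Real.pi * (Real.Gamma ((m : ℝ) + 3 / 2) / Real.Gamma ((m : ℝ) + 1))

/-- The measure `(2 / √π) * Γ(m + 3/2) / Γ(m + 1) * (1 - x^2)^m dx` on `[0, 1]`,
as a measure on `ℝ`. -/
def betaTypeLaw (m : ℕ) : Measure ℝ :=
  ((volume : Measure ℝ).restrict (Set.Icc 0 1)).withDensity
    (fun x => ENNReal.ofReal (normConst m * (1 - x ^ 2) ^ m))

/-- The random variable `Y` has moments `E(Y^(α - 1)) = ∏_{k=0}^m (1 + 2k) / (α + 2k)` for all
complex `α` with positive real part, all these expectations being absolutely convergent. -/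
def HasProductMoments {E : Type*} [MeasurableSpace E] (m : ℕ) (Y : E → ℝ) (μ : Measure E) : Prop :=
  ∀ α : ℂ, 0 < α.re →
    Integrable (fun e => (Y e : ℂ) ^ (α - 1)) μ ∧
      ∫ e, (Y e : ℂ) ^ (α - 1) ∂μ =
        ∏ k ∈ Finset.range (m + 1), (1 + 2 * (k : ℂ)) / (α + 2 * (k : ℂ))

end

/-! ### Polynomials with all roots in the closed unit disc -/

/-! Fix `|k| < 1`. A monic `Q` of degree `n + 1` with constant term `k` is uniquely `zP(z) + k
zⁿP(1/z)` with `P` monic of degree `n`, and `Q` has all roots in the closed disc iff `P` does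
(`snoc_levinsonMap_mem_polyRegion`). On coefficients this is the linear map `1 + k·reversal`, so the
slice of Ω_{n+1} at `a_{n+1} = k` has volume `det · vol Ω_n`. Pairing each coefficient with its
mirror image gives the determinant `(1 - k²)^(n/2)`, times `1 + k` when `n` is odd; adding the
values at `k` and `-k` gives the density of `|a_{n+1}|` up to a constant. The complex moments follow
by induction on `m`. Conversely, the moments at `α = n + 1` are the ordinary ones, which determine a
measure on `[0, 1]` by Weierstrass approximation. -/

lemma aeval_monicPoly {N : ℕ} (a : Fin N → ℝ) (z : ℂ) :
    aeval z (monicPoly a) = z ^ N + ∑ i : Fin N, (a i : ℂ) * z ^ (N - 1 - (i : ℕ)) := by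
  simp [monicPoly]

lemma degree_monicPoly_tail_lt {N : ℕ} (a : Fin N → ℝ) :
    (∑ i : Fin N, C (a i) * X ^ (N - 1 - (i : ℕ)) : ℝ[X]).degree < N := by
  rw [← mem_degreeLT]
  refine Submodule.sum_mem _ fun i _ => mem_degreeLT.2 ?_
  refine lt_of_le_of_lt (degree_C_mul_X_pow_le _ _) ?_
  exact_mod_cast (by have := i.2; omega : N - 1 - (i : ℕ) < N)

lemma monic_monicPoly {N : ℕ} (a : Fin N → ℝ) : (monicPoly a).Monic :=
  monic_X_pow_add (degree_monicPoly_tail_lt a)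

lemma natDegree_monicPoly {N : ℕ} (a : Fin N → ℝ) : (monicPoly a).natDegree = N := by
  refine natDegree_eq_of_degree_eq_some ?_
  rw [monicPoly, degree_add_eq_left_of_degree_lt] <;> rw [degree_X_pow]
  exact degree_monicPoly_tail_lt a

lemma exists_roots_of_mem_polyRegion {N : ℕ} {a : Fin N → ℝ} (ha : a ∈ polyRegion N) :
    ∃ s : Multiset ℂ, Multiset.card s = N ∧ (∀ r ∈ s, ‖r‖ ≤ 1) ∧
      ∀ w : ℂ, aeval w (monicPoly a) = (s.map (w - ·)).prod := by
  have hs : ((monicPoly a).map (algebraMap ℝ ℂ)).Splits := IsAlgClosed.splits _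
  refine ⟨(monicPoly a).aroots ℂ, ?_, ?_, fun w => ?_⟩
  · rw [aroots, ← hs.natDegree_eq_card_roots, natDegree_map, natDegree_monicPoly]
  · intro r hr
    exact ha r (mem_aroots.1 hr).2
  · exact hs.aeval_eq_prod_aroots_of_monic (monic_monicPoly a) w

/-- The left side is `|1 - z̄r|`, and `|z - r|² - |1 - z̄r|² = (|z|² - 1)(1 - |r|²)`. -/
lemma norm_mul_norm_conj_inv_sub_le {z r : ℂ} (hz : 1 ≤ ‖z‖) (hr : ‖r‖ ≤ 1) :
    ‖z‖ * ‖(starRingEnd ℂ z)⁻¹ - r‖ ≤ ‖z - r‖ := by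
  have hz0 : starRingEnd ℂ z ≠ 0 := by
    intro h
    rw [map_eq_zero] at h
    norm_num [h] at hz
  have h1 : ‖z‖ * ‖(starRingEnd ℂ z)⁻¹ - r‖ = ‖1 - starRingEnd ℂ z * r‖ := by
    rw [← Complex.norm_conj z, ← norm_mul, mul_sub, mul_inv_cancel₀ hz0]
  rw [h1]
  refine le_of_sq_le_sq ?_ (norm_nonneg _)
  have hz2 : 1 ≤ ‖z‖ ^ 2 := one_le_pow₀ hz
  have hr2 : ‖r‖ ^ 2 ≤ 1 := pow_le_one₀ (norm_nonneg _) hr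
  rw [← Complex.normSq_eq_norm_sq, Complex.normSq_apply] at *
  simp only [← Complex.normSq_eq_norm_sq, Complex.normSq_apply] at *
  simp
  nlinarith [mul_nonneg (sub_nonneg.2 hz2) (sub_nonneg.2 hr2)]

/-- Multiply the previous bound over the roots; real coefficients allow `1/z` to be replaced by
`1/z̄`. This domination drives both directions of the recursion. -/
lemma norm_pow_mul_aeval_inv_le {N : ℕ} {a : Fin N → ℝ} (ha : a ∈ polyRegion N) {z : ℂ}
    (hz : 1 ≤ ‖z‖) :
    ‖z ^ N * aeval z⁻¹ (monicPoly a)‖ ≤ ‖aeval z (monicPoly a)‖ := by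
  obtain ⟨s, hcard, hs, hP⟩ := exists_roots_of_mem_polyRegion ha
  have hconj : ‖aeval z⁻¹ (monicPoly a)‖ = ‖aeval (starRingEnd ℂ z)⁻¹ (monicPoly a)‖ := by
    rw [← map_inv₀, aeval_conj, Complex.norm_conj]
  rw [norm_mul, hconj, hP, hP, norm_pow, ← hcard]
  clear hcard hP
  induction s using Multiset.induction with
  | empty => simp
  | cons r s ih =>
    simp only [Multiset.card_cons, Multiset.map_cons, Multiset.prod_cons, norm_mul, pow_succ']
    calc _ = (‖z‖ * ‖(starRingEnd ℂ z)⁻¹ - r‖) * (‖z‖ ^ (Multiset.card s) *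
          ‖(s.map ((starRingEnd ℂ z)⁻¹ - ·)).prod‖) := by ring
      _ ≤ _ := mul_le_mul (norm_mul_norm_conj_inv_sub_le hz (hs r (Multiset.mem_cons_self r s)))
          (ih fun q hq => hs q (Multiset.mem_cons_of_mem hq)) (by positivity) (norm_nonneg _)

lemma pow_sub_one_le_norm_aeval {N : ℕ} {a : Fin N → ℝ} (ha : a ∈ polyRegion N) {z : ℂ}
    (hz : 1 ≤ ‖z‖) :
    (‖z‖ - 1) ^ N ≤ ‖aeval z (monicPoly a)‖ := by
  obtain ⟨s, hcard, hs, hP⟩ := exists_roots_of_mem_polyRegion ha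
  rw [hP, ← hcard]
  clear hcard hP
  induction s using Multiset.induction with
  | empty => simp
  | cons r s ih =>
    simp only [Multiset.card_cons, Multiset.map_cons, Multiset.prod_cons, norm_mul, pow_succ']
    have h1 := hs r (Multiset.mem_cons_self r s)
    have h2 := norm_sub_norm_le z r
    exact mul_le_mul (by linarith) (ih fun q hq => hs q (Multiset.mem_cons_of_mem hq))
      (pow_nonneg (by linarith) _) (norm_nonneg _)

lemma norm_aeval_zero_le_one {N : ℕ} {a : Fin N → ℝ} (ha : a ∈ polyRegion N) :
    ‖aeval (0 : ℂ) (monicPoly a)‖ ≤ 1 := by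
  obtain ⟨s, -, hs, hP⟩ := exists_roots_of_mem_polyRegion ha
  rw [hP]
  clear hP
  induction s using Multiset.induction with
  | empty => simp
  | cons r s ih =>
    simp only [Multiset.map_cons, Multiset.prod_cons, norm_mul, zero_sub, norm_neg]
    exact mul_le_one₀ (hs r (Multiset.mem_cons_self r s)) (norm_nonneg _)
      (by simpa using ih fun q hq => hs q (Multiset.mem_cons_of_mem hq))

lemma isClosed_polyRegion (N : ℕ) : IsClosed (polyRegion N) := by
  -- Non-strict bounds are closed conditions on `a`, and their positive left side still excludes
  -- roots outside the disc.
  have : polyRegion N =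
      ⋂ z : {z : ℂ // 1 < ‖z‖}, {a | (‖(z : ℂ)‖ - 1) ^ N ≤ ‖aeval (z : ℂ) (monicPoly a)‖} := by
    ext a
    simp only [Set.mem_iInter, Set.mem_ofPred_eq]
    refine ⟨fun ha z => pow_sub_one_le_norm_aeval ha z.2.le, fun h z hz => ?_⟩
    by_contra! hz1
    have := h ⟨z, hz1⟩
    simp only [hz, norm_zero] at this
    exact absurd this (not_le.2 (pow_pos (by linarith) N))
  rw [this]
  refine isClosed_iInter fun z => isClosed_le continuous_const ?_
  simp only [aeval_monicPoly]
  fun_prop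

/-- The coefficients other than the constant one of `x P(x) + k x^n P(1/x)`, as a function of
those of `P`. -/
def levinsonMap (n : ℕ) (k : ℝ) : (Fin n → ℝ) →ₗ[ℝ] (Fin n → ℝ) :=
  LinearMap.id + k • LinearMap.funLeft ℝ ℝ Fin.rev

lemma levinsonMap_apply (n : ℕ) (k : ℝ) (b : Fin n → ℝ) (i : Fin n) :
    levinsonMap n k b i = b i + k * b (Fin.rev i) := by
  simp [levinsonMap, LinearMap.funLeft_apply]

lemma aeval_monicPoly_snoc {n : ℕ} (b : Fin n → ℝ) (k : ℝ) (z : ℂ) :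
    aeval z (monicPoly (Fin.snoc b k : Fin (n + 1) → ℝ)) =
      z ^ (n + 1) + ∑ i : Fin n, (b i : ℂ) * z ^ (n - (i : ℕ)) + k := by
  rw [aeval_monicPoly, Fin.sum_univ_castSucc]
  simp [add_assoc]

/-- Since `zⁿP(1/z) = 1 + ∑ bᵢ z^(i+1)`, its constant term supplies `k` and its other coefficients
are `b` reversed. -/
lemma aeval_levinson {n : ℕ} (b : Fin n → ℝ) (k : ℝ) {z : ℂ} (hz : z ≠ 0) :
    aeval z (monicPoly (Fin.snoc (levinsonMap n k b) k : Fin (n + 1) → ℝ)) =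
      z * aeval z (monicPoly b) + k * (z ^ n * aeval z⁻¹ (monicPoly b)) := by
  rw [aeval_monicPoly_snoc, aeval_monicPoly, aeval_monicPoly]
  have h1 : ∑ i : Fin n, (b i : ℂ) * z ^ (n - (i : ℕ)) =
      z * ∑ i : Fin n, (b i : ℂ) * z ^ (n - 1 - (i : ℕ)) := by
    rw [Finset.mul_sum]
    refine Finset.sum_congr rfl fun i _ => ?_
    have : n - (i : ℕ) = n - 1 - i + 1 := by have := i.2; omega
    rw [this, pow_succ]; ring
  have h2 : ∑ i : Fin n, (b (Fin.rev i) : ℂ) * z ^ (n - (i : ℕ)) =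
      z ^ n * ∑ i : Fin n, (b i : ℂ) * z⁻¹ ^ (n - 1 - (i : ℕ)) := by
    rw [Finset.mul_sum, ← Equiv.sum_comp Fin.revPerm]
    refine Finset.sum_congr rfl fun i _ => ?_
    have hi := i.2
    have e1 : n - ((Fin.revPerm i : Fin n) : ℕ) = i + 1 := by
      simp only [Fin.revPerm_apply, Fin.val_rev]; omega
    have e2 : z ^ n = z ^ ((i : ℕ) + 1) * z ^ (n - 1 - (i : ℕ)) := by
      rw [← pow_add]; congr 1; omega
    rw [e1, e2, Fin.revPerm_apply, Fin.rev_rev, inv_pow]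
    field_simp
  have h3 : z ^ n * z⁻¹ ^ n = 1 := by rw [← mul_pow, mul_inv_cancel₀ hz, one_pow]
  simp only [levinsonMap_apply, Complex.ofReal_add, Complex.ofReal_mul, add_mul,
    Finset.sum_add_distrib, h1, mul_assoc, ← Finset.mul_sum, h2]
  linear_combination -(k : ℂ) * h3

/-- One step of the Schur–Cohn recursion. -/
lemma snoc_levinsonMap_mem_polyRegion {n : ℕ} (b : Fin n → ℝ) {k : ℝ} (hk : |k| < 1) :
    (Fin.snoc (levinsonMap n k b) k : Fin (n + 1) → ℝ) ∈ polyRegion (n + 1) ↔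
      b ∈ polyRegion n := by
  have hk' : ‖(k : ℂ)‖ < 1 := by simpa using hk
  constructor
  · intro h z hz
    by_contra! hz1
    have hz0 : z ≠ 0 := by rintro rfl; norm_num at hz1
    -- With `P(z) = 0` and `w = zⁿP(1/z)`, one has `Q(z) = kw` and `zⁿ⁺¹Q(1/z) = w`; domination for
    -- `Q` gives `|w| ≤ |k||w|` with `w ≠ 0`.
    have hQ := norm_pow_mul_aeval_inv_le h hz1.le
    have hne : aeval z (monicPoly (Fin.snoc (levinsonMap n k b) k : Fin (n + 1) → ℝ)) ≠ 0 :=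
      fun h0 => absurd (h z h0) (not_le.2 hz1)
    rw [aeval_levinson b k (inv_ne_zero hz0), inv_inv] at hQ
    rw [aeval_levinson b k hz0, hz, mul_zero, zero_add] at hne
    simp only [aeval_levinson b k hz0, hz, mul_zero, add_zero, zero_add] at hQ
    have e : z ^ (n + 1) * (z⁻¹ * aeval z⁻¹ (monicPoly b)) =
        z ^ n * aeval z⁻¹ (monicPoly b) := by
      rw [pow_succ]; field_simp
    rw [e, norm_mul (k : ℂ)] at hQ
    have hpos : 0 < ‖z ^ n * aeval z⁻¹ (monicPoly b)‖ := norm_pos_iff.2 (right_ne_zero_of_mul hne)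
    nlinarith
  · intro h z hz
    by_contra! hz1
    have hz0 : z ≠ 0 := by rintro rfl; norm_num at hz1
    -- A root `z` of `Q` would give `|z||P(z)| ≤ |k||P(z)|`, impossible as `|k| < 1 < |z|`.
    have hP := norm_pow_mul_aeval_inv_le h hz1.le
    have hne : aeval z (monicPoly b) ≠ 0 := fun h0 => absurd (h z h0) (not_le.2 hz1)
    rw [aeval_levinson b k hz0, add_eq_zero_iff_eq_neg] at hz
    have hn := congrArg norm hz
    rw [norm_neg, norm_mul, norm_mul (k : ℂ)] at hn
    have hpos : 0 < ‖aeval z (monicPoly b)‖ := norm_pos_iff.2 hne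
    nlinarith [norm_nonneg (k : ℂ), norm_nonneg (z ^ n * aeval z⁻¹ (monicPoly b))]

lemma eval_zero_monicPoly {n : ℕ} (a : Fin (n + 1) → ℝ) :
    (monicPoly a).eval 0 = a (Fin.last n) := by
  simp only [monicPoly, eval_add, eval_pow, eval_X, eval_finsetSum, eval_mul, eval_C]
  rw [Fin.sum_univ_castSucc]
  have : ∀ i : Fin n, a i.castSucc * (0 : ℝ) ^ (n + 1 - 1 - (i.castSucc : ℕ)) = 0 := by
    intro i
    rw [zero_pow, mul_zero]
    have := i.2
    simp only [Fin.val_castSucc]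
    omega
  rw [Finset.sum_eq_zero fun i _ => this i]
  simp

lemma absConstTerm_eq {n : ℕ} (a : Fin (n + 1) → ℝ) : absConstTerm a = |a (Fin.last n)| := by
  rw [absConstTerm, eval_zero_monicPoly]

lemma abs_last_le_one {n : ℕ} {a : Fin (n + 1) → ℝ} (ha : a ∈ polyRegion (n + 1)) :
    |a (Fin.last n)| ≤ 1 := by
  have h := norm_aeval_zero_le_one ha
  have h2 : aeval (0 : ℂ) (monicPoly a) = ((a (Fin.last n) : ℝ) : ℂ) := by
    rw [← eval_zero_monicPoly a, ← map_zero (algebraMap ℝ ℂ), aeval_algebraMap_apply]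
    simp
  simpa [h2] using h

/-! ### The Jacobian of the recursion -/

/-- Reindexing by `e` places mirror indices opposite each other, turning reversal into a block swap.
-/
lemma det_levinsonMap_eq_det_of_equiv {ι : Type*} [Fintype ι] [DecidableEq ι] {n : ℕ} (k : ℝ)
    (e : ι ≃ Fin n) (M : Matrix ι ι ℝ)
    (hM : ∀ i j, M i j = (if i = j then 1 else 0) + k * if (e i).rev = e j then 1 else 0) :
    LinearMap.det (levinsonMap n k) = M.det := by
  have h : levinsonMap n k = Matrix.toLin' (M.submatrix e.symm e.symm) := by
    ext b i
    simp [levinsonMap_apply, Matrix.mulVec, hM, dotProduct, Pi.single_apply]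
    rw [← Equiv.sum_comp e.symm]
    simp
  rw [h, LinearMap.det_toLin', Matrix.det_submatrix_equiv_self]

lemma det_levinsonMap_even (p : ℕ) (k : ℝ) :
    LinearMap.det (levinsonMap (p + p) k) = (1 - k ^ 2) ^ p := by
  rw [det_levinsonMap_eq_det_of_equiv k
    ((Equiv.sumCongr (Equiv.refl (Fin p)) Fin.revPerm).trans finSumFinEquiv)
    (Matrix.fromBlocks 1 (k • 1) (k • 1) 1)]
  · rw [Matrix.det_fromBlocks_one₂₂]
    have : (1 - k • (1 : Matrix (Fin p) (Fin p) ℝ) * (k • 1)) = (1 - k ^ 2) • 1 := by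
      rw [smul_mul_smul_comm, one_mul, sub_smul, one_smul, sq]
    rw [this, Matrix.det_smul, Matrix.det_one, mul_one, Fintype.card_fin]
  · rintro (i | i) (j | j)
    all_goals
      have hi := i.2
      have hj := j.2
      simp [Matrix.one_apply, Fin.ext_iff]
      try (intros; omega)
    all_goals (split_ifs <;> first | rfl | omega)

/-- The middle index is its own mirror and contributes `1 + k`; it sits last in the first block. -/
lemma det_levinsonMap_odd (p : ℕ) (k : ℝ) :
    LinearMap.det (levinsonMap (p + 1 + p) k) = (1 - k ^ 2) ^ p * (1 + k) := by
  rw [det_levinsonMap_eq_det_of_equiv k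
    ((Equiv.sumCongr (Equiv.refl (Fin (p + 1))) Fin.revPerm).trans finSumFinEquiv)
    (Matrix.fromBlocks (Matrix.diagonal (Fin.snoc (fun _ : Fin p => (1 : ℝ)) (1 + k)))
      (Matrix.of fun i j => if i = j.castSucc then k else 0)
      (Matrix.of fun i j => if i.castSucc = j then k else 0) 1)]
  · rw [Matrix.det_fromBlocks_one₂₂]
    have : Matrix.diagonal (Fin.snoc (fun _ : Fin p => (1 : ℝ)) (1 + k) : Fin (p + 1) → ℝ) -
        (Matrix.of fun (i : Fin (p + 1)) (j : Fin p) => if i = j.castSucc then k else 0) *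
          (Matrix.of fun (i : Fin p) (j : Fin (p + 1)) => if i.castSucc = j then k else 0) =
        Matrix.diagonal (Fin.snoc (fun _ : Fin p => (1 - k ^ 2 : ℝ)) (1 + k)) := by
      ext i j
      induction i using Fin.lastCases <;> induction j using Fin.lastCases <;>
        simp [Matrix.mul_apply, Matrix.diagonal_apply, sq]
      · exact fun h => absurd h.symm (Fin.castSucc_lt_last _).ne
      · split_ifs <;> ring
    rw [this, Matrix.det_diagonal, Fin.prod_univ_castSucc]
    simp
  · rintro (i | i) (j | j)
    · have hj := j.2
      induction i using Fin.lastCases with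
      | last =>
        simp [Matrix.diagonal_apply, Fin.ext_iff]
        split_ifs <;> first | omega | simp
      | cast i =>
        have hi := i.2
        simp [Matrix.diagonal_apply, Fin.ext_iff]
        intros
        omega
    all_goals
      have hi := i.2
      have hj := j.2
      simp [Matrix.one_apply, Fin.ext_iff]
      try (split_ifs <;> first | rfl | omega)
    intros
    omega

lemma det_levinsonMap (n : ℕ) (k : ℝ) :
    LinearMap.det (levinsonMap n k) =
      (1 - k ^ 2) ^ (n / 2) * (if Even n then 1 else 1 + k) := by
  obtain ⟨p, rfl | rfl⟩ := Nat.even_or_odd' n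
  · rw [if_pos (even_two_mul p), mul_one, Nat.mul_div_cancel_left p two_pos, two_mul,
      det_levinsonMap_even]
  · rw [if_neg (Nat.not_even_two_mul_add_one p), show (2 * p + 1) / 2 = p by omega,
      show 2 * p + 1 = p + 1 + p by omega, det_levinsonMap_odd]

lemma det_levinsonMap_pos {n : ℕ} {k : ℝ} (hk : |k| < 1) :
    0 < LinearMap.det (levinsonMap n k) := by
  rw [det_levinsonMap]
  have h := abs_lt.1 hk
  have h2 : 0 < 1 - k ^ 2 := by nlinarith
  split_ifs
  · positivity
  · exact mul_pos (pow_pos h2 _) (by linarith)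

/-- The odd factor cancels, `(1 + k) + (1 - k) = 2`, so taking absolute values removes the
dependence on parity. -/
lemma det_levinsonMap_add_neg (n : ℕ) (k : ℝ) :
    LinearMap.det (levinsonMap n k) + LinearMap.det (levinsonMap n (-k)) =
      2 * (1 - k ^ 2) ^ (n / 2) := by
  simp only [det_levinsonMap, neg_sq]
  split_ifs <;> ring

lemma continuous_det_levinsonMap (n : ℕ) :
    Continuous fun k => LinearMap.det (levinsonMap n k) := by
  simp only [det_levinsonMap]
  split_ifs <;> fun_prop

/-! ### The law of the constant term -/

lemma volume_slice_polyRegion {n : ℕ} {k : ℝ} (hk : |k| < 1) :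
    volume {b : Fin n → ℝ | (Fin.snoc b k : Fin (n + 1) → ℝ) ∈ polyRegion (n + 1)} =
      ENNReal.ofReal (LinearMap.det (levinsonMap n k)) * volume (polyRegion n) := by
  have hd := det_levinsonMap_pos (n := n) hk
  have hpre : levinsonMap n k ⁻¹'
      {b : Fin n → ℝ | (Fin.snoc b k : Fin (n + 1) → ℝ) ∈ polyRegion (n + 1)} = polyRegion n :=
    Set.ext fun b => snoc_levinsonMap_mem_polyRegion b hk
  have h := Measure.addHaar_preimage_linearMap volume hd.ne'
    {b : Fin n → ℝ | (Fin.snoc b k : Fin (n + 1) → ℝ) ∈ polyRegion (n + 1)}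
  rw [hpre] at h
  rw [h, abs_of_pos (inv_pos.2 hd), ← mul_assoc, ← ENNReal.ofReal_mul hd.le,
    mul_inv_cancel₀ hd.ne', ENNReal.ofReal_one, one_mul]

lemma volume_slice_polyRegion_eq_zero {n : ℕ} {k : ℝ} (hk : 1 < |k|) :
    volume {b : Fin n → ℝ | (Fin.snoc b k : Fin (n + 1) → ℝ) ∈ polyRegion (n + 1)} = 0 := by
  convert measure_empty (μ := (volume : Measure (Fin n → ℝ)))
  refine Set.eq_empty_of_forall_notMem fun b hb => ?_
  have := abs_last_le_one hb
  rw [Fin.snoc_last] at this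
  linarith

lemma lintegral_polyRegion_last (n : ℕ) {f : ℝ → ENNReal} (hf : Measurable f) :
    ∫⁻ a in polyRegion (n + 1), f (a (Fin.last n)) =
      (∫⁻ k in Set.Ioo (-1 : ℝ) 1, f k * ENNReal.ofReal (LinearMap.det (levinsonMap n k))) *
        volume (polyRegion n) := by
  have hmeas : MeasurableSet (polyRegion (n + 1)) := (isClosed_polyRegion _).measurableSet
  have hg : Measurable ((polyRegion (n + 1)).indicator
      fun a : Fin (n + 1) → ℝ => f (a (Fin.last n))) :=
    (hf.comp (measurable_pi_apply _)).indicator hmeas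
  have mp := (volume_preserving_piFinSuccAbove (fun _ : Fin (n + 1) => ℝ) (Fin.last n)).symm
  have hsymm : ∀ (k : ℝ) (b : Fin n → ℝ),
      (MeasurableEquiv.piFinSuccAbove (fun _ : Fin (n + 1) => ℝ) (Fin.last n)).symm (k, b) =
        Fin.snoc b k := fun k b => by
    simp [MeasurableEquiv.piFinSuccAbove, Fin.snocEquiv]
  have hcont : ∀ k : ℝ, Continuous fun b : Fin n → ℝ => (Fin.snoc b k : Fin (n + 1) → ℝ) :=
    fun k => Continuous.finSnoc (A := fun _ => ℝ) continuous_id continuous_const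
  rw [← lintegral_indicator hmeas, ← mp.lintegral_comp hg, Measure.volume_eq_prod,
    lintegral_prod (fun p => (polyRegion (n + 1)).indicator _ (MeasurableEquiv.symm _ p))
      (hg.comp (MeasurableEquiv.measurable _)).aemeasurable,
    ← lintegral_mul_const (f := fun k => f k * ENNReal.ofReal (LinearMap.det (levinsonMap n k))) _
      (hf.mul (continuous_det_levinsonMap n).measurable.ennreal_ofReal),
    ← lintegral_indicator measurableSet_Ioo]
  refine lintegral_congr_ae ?_
  -- The recursion says nothing at `|k| = 1`, a null set.
  have h1 : ∀ᵐ k : ℝ, k ≠ 1 := by simp [ae_iff]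
  have h2 : ∀ᵐ k : ℝ, k ≠ -1 := by simp [ae_iff]
  filter_upwards [h1, h2] with k hk1 hk2
  have hslice : ∫⁻ b : Fin n → ℝ, (polyRegion (n + 1)).indicator
        (fun a : Fin (n + 1) → ℝ => f (a (Fin.last n))) (Fin.snoc b k) =
      f k * volume {b : Fin n → ℝ | (Fin.snoc b k : Fin (n + 1) → ℝ) ∈ polyRegion (n + 1)} := by
    rw [← lintegral_indicator_const
      (s := {b : Fin n → ℝ | (Fin.snoc b k : Fin (n + 1) → ℝ) ∈ polyRegion (n + 1)})
      (((isClosed_polyRegion (n + 1)).preimage (hcont k)).measurableSet)]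
    refine lintegral_congr fun b => ?_
    by_cases hb : (Fin.snoc b k : Fin (n + 1) → ℝ) ∈ polyRegion (n + 1) <;>
      simp [Set.indicator, hb]
  simp only [hsymm]
  rw [hslice]
  by_cases hk : |k| < 1
  · rw [volume_slice_polyRegion hk, Set.indicator_of_mem (Set.mem_Ioo.2 (abs_lt.1 hk)), mul_assoc]
  · have hk' : 1 < |k| := lt_of_le_of_ne (not_lt.1 hk) fun h => by
      rcases (abs_eq zero_le_one).1 h.symm with h | h
      exacts [hk1 h, hk2 h]
    rw [volume_slice_polyRegion_eq_zero hk', mul_zero,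
      Set.indicator_of_notMem fun h => hk (abs_lt.2 (Set.mem_Ioo.1 h))]

lemma lintegral_Ioo_abs_mul_det (n : ℕ) {f : ℝ → ENNReal} (hf : Measurable f) :
    ∫⁻ k in Set.Ioo (-1 : ℝ) 1, f |k| * ENNReal.ofReal (LinearMap.det (levinsonMap n k)) =
      ∫⁻ x in Set.Icc (0 : ℝ) 1, f x * ENNReal.ofReal (2 * (1 - x ^ 2) ^ (n / 2)) := by
  set g : ℝ → ENNReal := fun k => f |k| * ENNReal.ofReal (LinearMap.det (levinsonMap n k)) with hg
  have hgm : Measurable g :=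
    (hf.comp measurable_id.abs).mul (continuous_det_levinsonMap n).measurable.ennreal_ofReal
  have hsplit : Set.Ioo (-1 : ℝ) 1 = Set.Ioo (-1) 0 ∪ Set.Ico 0 1 :=
    (Set.Ioo_union_Ico_eq_Ioo (by norm_num) (by norm_num)).symm
  have hneg : ∫⁻ k in Set.Ioo (-1 : ℝ) 0, g k = ∫⁻ k in Set.Ioo (0 : ℝ) 1, g (-k) := by
    have h := (Measure.measurePreserving_neg (volume : Measure ℝ)).setLIntegral_comp_preimage
      (s := Set.Ioo (-1 : ℝ) 0) measurableSet_Ioo hgm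
    rw [← h]
    simp
  rw [hsplit, lintegral_union measurableSet_Ico (by
      rw [Set.disjoint_left]; intro x hx hx'; exact absurd hx.2 (not_lt.2 hx'.1)), hneg,
    setLIntegral_congr (Ioo_ae_eq_Ico (μ := volume)).symm, setLIntegral_congr
      (Ioo_ae_eq_Icc (μ := volume) (a := (0 : ℝ)) (b := 1)).symm,
    ← lintegral_add_left (f := fun k => g (-k)) (hgm.comp measurable_neg)]
  refine setLIntegral_congr_fun measurableSet_Ioo fun x hx => ?_
  have hx1 : |x| < 1 := abs_lt.2 ⟨by linarith [hx.1], hx.2⟩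
  simp only [hg, abs_neg, abs_of_pos hx.1]
  rw [← mul_add, ← ENNReal.ofReal_add (det_levinsonMap_pos (by rwa [abs_neg])).le
    (det_levinsonMap_pos hx1).le, add_comm, det_levinsonMap_add_neg]

lemma measurable_absConstTerm (N : ℕ) : Measurable (absConstTerm : (Fin N → ℝ) → ℝ) := by
  cases N with
  | zero => exact measurable_of_countable _
  | succ n =>
    have : (absConstTerm : (Fin (n + 1) → ℝ) → ℝ) = fun a => |a (Fin.last n)| :=
      funext absConstTerm_eq
    rw [this]
    exact (measurable_pi_apply _).abs

/-- The unnormalized law of the constant term. -/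
lemma map_absConstTerm_restrict (n : ℕ) :
    Measure.map absConstTerm ((volume : Measure (Fin (n + 1) → ℝ)).restrict (polyRegion (n + 1))) =
      volume (polyRegion n) • ((volume : Measure ℝ).restrict (Set.Icc 0 1)).withDensity
        (fun x => ENNReal.ofReal (2 * (1 - x ^ 2) ^ (n / 2))) := by
  refine Measure.ext_of_lintegral _ fun f hf => ?_
  rw [lintegral_map hf (measurable_absConstTerm _), lintegral_smul_measure,
    lintegral_withDensity_eq_lintegral_mul _ (by fun_prop) hf]
  simp only [absConstTerm_eq]
  rw [lintegral_polyRegion_last n (f := fun x => f |x|) (hf.comp measurable_id.abs),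
    lintegral_Ioo_abs_mul_det n hf, smul_eq_mul, mul_comm]
  simp only [Pi.mul_apply, mul_comm]

/-! ### Moments of the beta type law -/

lemma intervalIntegrable_cpow_mul_one_sub_sq_pow {α : ℂ} (hα : 0 < α.re) (m : ℕ) :
    IntervalIntegrable (fun x : ℝ => (x : ℂ) ^ (α - 1) * ((1 - x ^ 2) ^ m : ℝ)) volume 0 1 :=
  (intervalIntegral.intervalIntegrable_cpow' (by simpa using hα)).mul_continuousOn (by fun_prop)

lemma integral_cpow_mul_one_sub_sq_pow (m : ℕ) {α : ℂ} (hα : 0 < α.re) :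
    ∫ x in (0 : ℝ)..1, (x : ℂ) ^ (α - 1) * ((1 - x ^ 2) ^ m : ℝ) =
      2 ^ m * (m.factorial : ℂ) / ∏ k ∈ Finset.range (m + 1), (α + 2 * (k : ℂ)) := by
  have hne : ∀ {β : ℂ}, 0 < β.re → ∀ k : ℕ, β + 2 * (k : ℂ) ≠ 0 := by
    intro β hβ k h
    have := congrArg Complex.re h
    simp at this
    have hk : (0 : ℝ) ≤ k := k.cast_nonneg
    linarith
  induction m generalizing α with
  | zero =>
    have h := integral_cpow (a := 0) (b := 1) (r := α - 1) (Or.inl (by simpa using hα))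
    have h0 : α ≠ 0 := by rintro rfl; simp at hα
    simpa [Complex.zero_cpow h0] using h
  | succ m ih =>
    have hα2 : 0 < (α + 2).re := by simp; linarith
    -- Expanding one factor `1 - x²` relates the integral to those at `α` and `α + 2`.
    have hstep : ∫ x in (0 : ℝ)..1, (x : ℂ) ^ (α - 1) * ((1 - x ^ 2) ^ (m + 1) : ℝ) =
        (∫ x in (0 : ℝ)..1, (x : ℂ) ^ (α - 1) * ((1 - x ^ 2) ^ m : ℝ)) -
          ∫ x in (0 : ℝ)..1, (x : ℂ) ^ (α + 2 - 1) * ((1 - x ^ 2) ^ m : ℝ) := by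
      rw [← intervalIntegral.integral_sub (intervalIntegrable_cpow_mul_one_sub_sq_pow hα m)
        (intervalIntegrable_cpow_mul_one_sub_sq_pow hα2 m)]
      refine intervalIntegral.integral_congr_ae (Filter.Eventually.of_forall fun x hx => ?_)
      rw [Set.uIoc_of_le zero_le_one] at hx
      have hx0 : (x : ℂ) ≠ 0 := by exact_mod_cast hx.1.ne'
      have : (x : ℂ) ^ (α + 2 - 1) = (x : ℂ) ^ (α - 1) * (x : ℂ) ^ 2 := by
        rw [show α + 2 - 1 = (α - 1) + (2 : ℕ) by push_cast; ring, Complex.cpow_add _ _ hx0,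
          Complex.cpow_natCast]
      rw [this]
      push_cast
      ring
    -- Both denominators share the factors `α + 2, …, α + 2m`, isolated below as `p`.
    rw [hstep, ih hα, ih hα2, Finset.prod_range_succ' _ m, Finset.prod_range_succ _ m,
      Finset.prod_range_succ' _ (m + 1), Finset.prod_range_succ _ m, Nat.factorial_succ]
    have hshift : ∀ k : ℕ, α + 2 + 2 * (k : ℂ) = α + 2 * ((k + 1 : ℕ) : ℂ) := by
      intro k; push_cast; ring
    simp only [hshift]
    have hp : ∏ k ∈ Finset.range m, (α + 2 * ((k + 1 : ℕ) : ℂ)) ≠ 0 :=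
      Finset.prod_ne_zero_iff.2 fun k _ => hne hα _
    have h0 := hne hα 0
    have h1 := hne hα (m + 1)
    generalize ∏ k ∈ Finset.range m, (α + 2 * ((k + 1 : ℕ) : ℂ)) = p at hp
    push_cast at h0 h1 ⊢
    field_simp
    ring

lemma integral_one_sub_sq_pow (m : ℕ) :
    ∫ x in (0 : ℝ)..1, (1 - x ^ 2) ^ m =
      2 ^ m * (m.factorial : ℝ) / ∏ k ∈ Finset.range (m + 1), (1 + 2 * (k : ℝ)) := by
  have h := integral_cpow_mul_one_sub_sq_pow m (α := 1) (by simp)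
  simp only [sub_self, Complex.cpow_zero, one_mul] at h
  rw [intervalIntegral.integral_ofReal] at h
  apply Complex.ofReal_injective
  rw [h]
  push_cast
  rfl

lemma normConst_eq_prod_div (m : ℕ) :
    normConst m = (∏ k ∈ Finset.range (m + 1), (1 + 2 * (k : ℝ))) / (2 ^ m * (m.factorial : ℝ)) := by
  have hπ : √Real.pi ≠ 0 := by positivity
  induction m with
  | zero =>
    have : Real.Gamma (3 / 2) = 1 / 2 * √Real.pi := by
      rw [show (3 / 2 : ℝ) = 1 / 2 + 1 by norm_num, Real.Gamma_add_one (by norm_num),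
        Real.Gamma_one_half_eq]
    simp [normConst, this]
    field_simp
  | succ m ih =>
    have hg : Real.Gamma ((m : ℝ) + 1) ≠ 0 := (Real.Gamma_pos_of_pos (by positivity)).ne'
    have e1 : Real.Gamma (((m + 1 : ℕ) : ℝ) + 3 / 2) =
        ((m : ℝ) + 3 / 2) * Real.Gamma ((m : ℝ) + 3 / 2) := by
      rw [← Real.Gamma_add_one (by positivity)]; congr 1; push_cast; ring
    have e2 : Real.Gamma (((m + 1 : ℕ) : ℝ) + 1) = ((m : ℝ) + 1) * Real.Gamma ((m : ℝ) + 1) := by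
      rw [← Real.Gamma_add_one (by positivity)]; push_cast; rfl
    have hs : normConst (m + 1) = normConst m * (((m : ℝ) + 3 / 2) / ((m : ℝ) + 1)) := by
      rw [normConst, normConst, e1, e2]
      field_simp
    rw [hs, ih, Finset.prod_range_succ _ (m + 1), Nat.factorial_succ]
    push_cast
    field_simp
    ring

lemma normConst_pos (m : ℕ) : 0 < normConst m := by
  rw [normConst_eq_prod_div]
  have : 0 < ∏ k ∈ Finset.range (m + 1), (1 + 2 * (k : ℝ)) :=
    Finset.prod_pos fun k _ => by positivity
  positivity

lemma normConst_eq_one_div_integral (m : ℕ) :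
    normConst m = 1 / ∫ x in (0 : ℝ)..1, (1 - x ^ 2) ^ m := by
  rw [integral_one_sub_sq_pow, normConst_eq_prod_div, one_div_div]

lemma density_nonneg (m : ℕ) {x : ℝ} (hx : x ∈ Set.Icc (0 : ℝ) 1) :
    0 ≤ normConst m * (1 - x ^ 2) ^ m :=
  mul_nonneg (normConst_pos m).le (pow_nonneg (by nlinarith [hx.1, hx.2]) _)

lemma isProbabilityMeasure_betaTypeLaw (m : ℕ) : IsProbabilityMeasure (betaTypeLaw m) := by
  constructor
  have hc : Continuous fun x : ℝ => normConst m * (1 - x ^ 2) ^ m := by fun_prop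
  rw [betaTypeLaw, withDensity_apply _ MeasurableSet.univ, Measure.restrict_univ,
    ← ofReal_integral_eq_lintegral_ofReal hc.integrableOn_Icc
      (ae_restrict_of_forall_mem measurableSet_Icc fun x hx => density_nonneg m hx),
    integral_Icc_eq_integral_Ioc, ← intervalIntegral.integral_of_le zero_le_one,
    intervalIntegral.integral_const_mul, normConst_eq_one_div_integral, one_div_mul_cancel,
    ENNReal.ofReal_one]
  -- If the integral vanished, the convention `1 / 0 = 0` would contradict `normConst_pos`.
  intro h
  have := normConst_pos m
  rw [normConst_eq_one_div_integral, h] at this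
  simp at this

lemma betaTypeLaw_compl_Icc (m : ℕ) : betaTypeLaw m (Set.Icc 0 1)ᶜ = 0 := by
  refine withDensity_absolutelyContinuous _ _ ?_
  rw [Measure.restrict_apply measurableSet_Icc.compl, Set.compl_inter_self, measure_empty]

lemma hasProductMoments_betaTypeLaw (m : ℕ) : HasProductMoments m id (betaTypeLaw m) := by
  intro α hα
  have hmeas : Measurable fun x : ℝ => ENNReal.ofReal (normConst m * (1 - x ^ 2) ^ m) := by fun_prop
  have hfin : ∀ᵐ x ∂(volume : Measure ℝ).restrict (Set.Icc 0 1),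
      ENNReal.ofReal (normConst m * (1 - x ^ 2) ^ m) < ⊤ := by simp
  have hcongr : ∀ x ∈ Set.Icc (0 : ℝ) 1,
      (ENNReal.ofReal (normConst m * (1 - x ^ 2) ^ m)).toReal • ((id x : ℝ) : ℂ) ^ (α - 1) =
        (normConst m : ℂ) * ((x : ℂ) ^ (α - 1) * ((1 - x ^ 2) ^ m : ℝ)) := by
    intro x hx
    rw [ENNReal.toReal_ofReal (density_nonneg m hx), Complex.real_smul]
    push_cast
    simp only [id]
    ring
  constructor
  · rw [betaTypeLaw, integrable_withDensity_iff_integrable_smul' hmeas hfin]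
    refine IntegrableOn.congr_fun ?_ (fun x hx => (hcongr x hx).symm) measurableSet_Icc
    rw [integrableOn_Icc_iff_integrableOn_Ioc, ← intervalIntegrable_iff_integrableOn_Ioc_of_le
      zero_le_one]
    exact (intervalIntegrable_cpow_mul_one_sub_sq_pow hα m).const_mul _
  · rw [betaTypeLaw, integral_withDensity_eq_integral_toReal_smul hmeas hfin,
      setIntegral_congr_fun measurableSet_Icc hcongr, integral_Icc_eq_integral_Ioc,
      ← intervalIntegral.integral_of_le zero_le_one, intervalIntegral.integral_const_mul,
      integral_cpow_mul_one_sub_sq_pow m hα, normConst_eq_prod_div, Finset.prod_div_distrib]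
    push_cast
    have : (m.factorial : ℂ) ≠ 0 := by exact_mod_cast m.factorial_ne_zero
    field_simp

/-! ### Determination by moments -/

lemma integral_pow_eq_of_hasProductMoments {m : ℕ} {ν : Measure ℝ} (h : HasProductMoments m id ν)
    (n : ℕ) :
    ((∫ x, x ^ n ∂ν : ℝ) : ℂ) =
      ∏ k ∈ Finset.range (m + 1), (1 + 2 * (k : ℂ)) / ((n + 1 : ℂ) + 2 * (k : ℂ)) := by
  rw [← (h (n + 1 : ℂ) (by simp; positivity)).2, ← integral_complex_ofReal]
  simp

/-- A probability measure on `[0, 1]` is determined by its moments. -/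
lemma eq_of_forall_integral_pow_eq {μ ν : Measure ℝ} [IsProbabilityMeasure μ]
    [IsProbabilityMeasure ν] (hμ : μ (Set.Icc 0 1)ᶜ = 0) (hν : ν (Set.Icc 0 1)ᶜ = 0)
    (h : ∀ n : ℕ, ∫ x, x ^ n ∂μ = ∫ x, x ^ n ∂ν) : μ = ν := by
  have hint : ∀ {ρ : Measure ℝ} [IsProbabilityMeasure ρ], ρ (Set.Icc 0 1)ᶜ = 0 →
      ∀ p : ℝ[X], Integrable (fun x => p.eval x) ρ := by
    intro ρ _ hρ p
    rw [← Measure.restrict_eq_self_of_ae_mem (μ := ρ) (s := Set.Icc 0 1) hρ]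
    exact p.continuous.integrableOn_Icc
  have hpoly : ∀ p : ℝ[X], ∫ x, p.eval x ∂μ = ∫ x, p.eval x ∂ν := by
    intro p
    have hm : ∀ {ρ : Measure ℝ} [IsProbabilityMeasure ρ], ρ (Set.Icc 0 1)ᶜ = 0 →
        ∫ x, p.eval x ∂ρ = ∑ i ∈ p.support, p.coeff i * ∫ x, x ^ i ∂ρ := by
      intro ρ _ hρ
      simp only [eval_eq_sum, Polynomial.sum]
      rw [integral_finsetSum _ fun i _ => Integrable.const_mul
        (by simpa using hint hρ (X ^ i)) _]
      simp only [integral_const_mul]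
    simp only [hm hμ, hm hν, h]
  have hclose : ∀ {ρ : Measure ℝ} [IsProbabilityMeasure ρ], ρ (Set.Icc 0 1)ᶜ = 0 →
      ∀ (f : BoundedContinuousFunction ℝ ℝ) (p : ℝ[X]) (ε : ℝ),
      (∀ x ∈ Set.Icc (0 : ℝ) 1, |p.eval x - f x| < ε) →
        |(∫ x, p.eval x ∂ρ) - ∫ x, f x ∂ρ| ≤ ε := by
    intro ρ _ hρ f p ε hp
    rw [← integral_sub (hint hρ p) (f.integrable ρ)]
    have hae : ∀ᵐ x ∂ρ, x ∈ Set.Icc (0 : ℝ) 1 := hρ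
    simpa using norm_integral_le_of_norm_le_const (μ := ρ) (f := fun x => p.eval x - f x) (C := ε)
      (hae.mono fun x hx => (hp x hx).le)
  refine ext_of_forall_integral_eq_of_IsFiniteMeasure fun f => ?_
  refine eq_of_abs_sub_le_all fun ε hε => ?_
  -- An error `ε / 2` is spent on each of the two measures.
  obtain ⟨p, hp⟩ := exists_polynomial_near_of_continuousOn 0 1 f f.continuous.continuousOn (ε / 2)
    (by positivity)
  have h1 := abs_le.1 (hclose hμ f p _ hp)
  have h2 := abs_le.1 (hclose hν f p _ hp)
  rw [hpoly p] at h1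
  exact abs_le.2 ⟨by linarith [h1.1, h2.2], by linarith [h1.2, h2.1]⟩

lemma eq_betaTypeLaw_iff {m : ℕ} {ν : Measure ℝ} (hp : IsProbabilityMeasure ν)
    (hν : ν (Set.Icc 0 1)ᶜ = 0) : ν = betaTypeLaw m ↔ HasProductMoments m id ν := by
  refine ⟨fun h => h ▸ hasProductMoments_betaTypeLaw m, fun h => ?_⟩
  have := isProbabilityMeasure_betaTypeLaw m
  refine eq_of_forall_integral_pow_eq hν (betaTypeLaw_compl_Icc m) fun n => ?_
  have h1 := integral_pow_eq_of_hasProductMoments h n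
  rw [← integral_pow_eq_of_hasProductMoments (hasProductMoments_betaTypeLaw m) n] at h1
  exact_mod_cast h1

/-! ### Normalization and conclusion -/

lemma withDensity_one_sub_sq_pow (m : ℕ) :
    ((volume : Measure ℝ).restrict (Set.Icc 0 1)).withDensity
        (fun x => ENNReal.ofReal (2 * (1 - x ^ 2) ^ m)) =
      ENNReal.ofReal (2 / normConst m) • betaTypeLaw m := by
  have hpos := normConst_pos m
  rw [betaTypeLaw, ← withDensity_smul _ (by fun_prop)]
  congr 1
  funext x
  rw [Pi.smul_apply, smul_eq_mul, ← ENNReal.ofReal_mul (by positivity)]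
  congr 1
  field_simp

lemma map_absConstTerm_restrict_eq_smul (n : ℕ) :
    Measure.map absConstTerm ((volume : Measure (Fin (n + 1) → ℝ)).restrict (polyRegion (n + 1))) =
      (volume (polyRegion n) * ENNReal.ofReal (2 / normConst (n / 2))) •
        betaTypeLaw (n / 2) := by
  rw [map_absConstTerm_restrict, withDensity_one_sub_sq_pow, smul_smul]

/-- Compare total masses in the unnormalized law. -/
lemma volume_polyRegion_succ (n : ℕ) :
    volume (polyRegion (n + 1)) =
      volume (polyRegion n) * ENNReal.ofReal (2 / normConst (n / 2)) := by
  have h := congrArg (fun μ => μ Set.univ) (map_absConstTerm_restrict_eq_smul n)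
  have := isProbabilityMeasure_betaTypeLaw (n / 2)
  simpa [Measure.map_apply (measurable_absConstTerm _) MeasurableSet.univ] using h

/-- Ω_0 is the single point of `ℝ⁰`, of mass one, and each step multiplies by a positive finite
constant. -/
lemma volume_polyRegion_ne (N : ℕ) :
    volume (polyRegion N) ≠ 0 ∧ volume (polyRegion N) ≠ ⊤ := by
  induction N with
  | zero =>
    have : polyRegion 0 = Set.univ := by
      refine Set.eq_univ_of_forall fun a z hz => ?_
      simp [aeval_monicPoly] at hz
    rw [this, ← Set.pi_univ Set.univ, volume_pi_pi]
    simp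
  | succ n ih =>
    rw [volume_polyRegion_succ]
    have hpos : 0 < 2 / normConst (n / 2) := div_pos two_pos (normConst_pos _)
    exact ⟨mul_ne_zero ih.1 (ENNReal.ofReal_pos.2 hpos).ne',
      ENNReal.mul_ne_top ih.2 ENNReal.ofReal_ne_top⟩

lemma map_absConstTerm_uniformPoly (n : ℕ) :
    Measure.map absConstTerm (uniformPoly (n + 1)) = betaTypeLaw (n / 2) := by
  obtain ⟨h0, htop⟩ := volume_polyRegion_ne (n + 1)
  rw [uniformPoly, ProbabilityTheory.cond, Measure.map_smul, map_absConstTerm_restrict_eq_smul,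
    ← volume_polyRegion_succ, smul_smul, ENNReal.inv_mul_cancel h0 htop, one_smul]

lemma hasProductMoments_map {E : Type*} [MeasurableSpace E] {m : ℕ} {Y : E → ℝ} {μ : Measure E}
    (hY : Measurable Y) (h : HasProductMoments m id (μ.map Y)) : HasProductMoments m Y μ := by
  intro α hα
  have hm : Measurable fun x : ℝ => ((id x : ℝ) : ℂ) ^ (α - 1) := by fun_prop
  obtain ⟨h1, h2⟩ := h α hα
  rw [integrable_map_measure hm.aestronglyMeasurable hY.aemeasurable] at h1
  rw [integral_map hY.aemeasurable hm.aestronglyMeasurable] at h2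
  exact ⟨h1, h2⟩

theorem mainTheorem8 (N m : ℕ) (hN : 1 ≤ N) (hm : m = (N - 1) / 2) :
    -- the distribution of `|a_N|` on `Ω_N`
    Measure.map absConstTerm (uniformPoly N) = betaTypeLaw m ∧
    -- the two forms of the normalizing constant agree
    normConst m = 1 / ∫ x in (0 : ℝ)..1, (1 - x ^ 2) ^ m ∧
    -- the moments of `|a_N|` on `Ω_N`
    HasProductMoments m absConstTerm (uniformPoly N) ∧
    -- among probability measures on `[0, 1]`, the law and its moments determine each other
    (∀ ν : Measure ℝ, IsProbabilityMeasure ν → ν (Set.Icc 0 1)ᶜ = 0 →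
      (ν = betaTypeLaw m ↔ HasProductMoments m id ν)) := by
  obtain ⟨n, rfl⟩ : ∃ n, N = n + 1 := ⟨N - 1, by omega⟩
  obtain rfl : m = n / 2 := hm
  have hlaw := map_absConstTerm_uniformPoly n
  refine ⟨hlaw, normConst_eq_one_div_integral _, ?_, fun ν hp hν => eq_betaTypeLaw_iff hp hν⟩
  exact hasProductMoments_map (measurable_absConstTerm _)
    (hlaw ▸ hasProductMoments_betaTypeLaw (n / 2))
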